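/- Let $\mathcal H$ be a Hilbert space of finite dimension $d$ over $\mathbb C$, let $\mathcal H_{\rm anc}\cong\mathcal H$ be an ancillary Hilbert space, and let $|\chi_1\rangle,\dots,|\chi_d\rangle\in\mathcal H$ be unit vectors (the classical pure states). For $|\psi\rangle\in\mathcal H$ let the nonclassical rank $\mathrm{NR}(|\psi\rangle)$ be the least number $r$ such that $|\psi\rangle$ is a linear combination of $r$ of the $|\chi_i\rangle$ with nonzero complex coefficients; for $|\phi\rangle\in\mathcal H\otimes\mathcal H_{\rm anc}$ let the Schmidt rank $\mathrm{SR}(|\phi\rangle)$ be the number of terms in a Schmidt decomposition $|\phi\rangle=\sum_{i=1}^{r}\lambda_i\,|e_i\rangle\otimes|f_i\rangle$ ($\lambda_i>0$, $\{|e_i\rangle\}$ and $\{|f_i\rangle\}$ orthonormal). For a density operator $\rho$ on $\mathcal H$, respectively $\sigma$ on $\mathcal H\otimes\mathcal H_{\rm anc}$, define the nonclassical number and the Schmidt number by $$\mathrm{NN}(\rho)=\min_{\{p_i,|\psi_i\rangle\}}\max_i \mathrm{NR}(|\psi_i\rangle),\qquad \mathrm{SN}(\sigma)=\min_{\{q_i,|\phi_i\rangle\}}\max_i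 \mathrm{SR}(|\phi_i\rangle),$$ where the minima are over all finite convex decompositions $\rho=\sum_i p_i|\psi_i\rangle\langle\psi_i|$, respectively $\sigma=\sum_i q_i|\phi_i\rangle\langle\phi_i|$, into pure states (unit vectors) with positive weights summing to $1$. If $|\chi_1\rangle,\dots,|\chi_d\rangle$ are linearly independent and span $\mathcal H$, then there exists a linear isometry $\Gamma:\mathcal H\to\mathcal H\otimes\mathcal H_{\rm anc}$ such that, for every density operator $\rho$ on $\mathcal H$, $$\mathrm{NN}(\rho)=\mathrm{SN}(\Gamma\rho\Gamma^\dagger).$$ -/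

import Mathlib

open scoped TensorProduct

noncomputable section

/-- A density operator: positive semidefinite with unit trace. -/
def IsDensityOperator {E : Type*} [NormedAddCommGroup E] [InnerProductSpace ℂ E]
    (ρ : E →ₗ[ℂ] E) : Prop :=
  ρ.IsPositive ∧ LinearMap.trace ℂ E ρ = 1

/-- The operator `|ψ⟩⟨ψ|`, sending `x` to `⟪ψ, x⟫ • ψ`. -/
def ketBra {E : Type*} [NormedAddCommGroup E] [InnerProductSpace ℂ E]
    (ψ : E) : E →ₗ[ℂ] E :=
  (InnerProductSpace.rankOne ℂ ψ ψ).toLinearMap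

/-- The weights `p` and vectors `ψ` form a (finite) pure-state convex decomposition
`ρ = ∑ i, p i |ψ i⟩⟨ψ i|` of `ρ`. -/
structure IsPureDecomposition {E : Type*} [NormedAddCommGroup E] [InnerProductSpace ℂ E]
    (ρ : E →ₗ[ℂ] E) {n : ℕ} (p : Fin n → ℝ) (ψ : Fin n → E) : Prop where
  pos : ∀ i, 0 < p i
  sum_eq_one : ∑ i, p i = 1
  norm_eq_one : ∀ i, ‖ψ i‖ = 1
  eq_sum : ρ = ∑ i, (p i : ℂ) • ketBra (ψ i)

/-- Extension of a rank function `R` from pure to mixed states: the minimum, over all pure-state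
convex decompositions, of the maximum of `R` over the pure states of the decomposition. -/
def mixedExtension {E : Type*} [NormedAddCommGroup E] [InnerProductSpace ℂ E]
    (R : E → ℕ∞) (ρ : E →ₗ[ℂ] E) : ℕ∞ :=
  sInf {m : ℕ∞ | ∃ (n : ℕ) (p : Fin n → ℝ) (ψ : Fin n → E),
    IsPureDecomposition ρ p ψ ∧ m = ⨆ i, R (ψ i)}

/-- Nonclassical rank of `ψ` with respect to the classical pure states `χ`: the least number of
classical states in an expansion of `ψ` with nonzero coefficients. -/
def nonclassicalRank {ι E : Type*} [NormedAddCommGroup E] [InnerProductSpace ℂ E]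
    (χ : ι → E) (ψ : E) : ℕ∞ :=
  sInf {r : ℕ∞ | ∃ (s : Finset ι) (c : ι → ℂ),
    (∀ i ∈ s, c i ≠ 0) ∧ ψ = ∑ i ∈ s, c i • χ i ∧ r = (s.card : ℕ∞)}

/-- Schmidt rank of `ψ`: the number of terms in a Schmidt decomposition
`ψ = ∑ i, l i • (e i ⊗ f i)`, with `e` and `f` orthonormal families and `l i > 0`.
(All Schmidt decompositions of `ψ` have the same number of terms.) -/
def schmidtRank {E F : Type*} [NormedAddCommGroup E] [InnerProductSpace ℂ E]
    [NormedAddCommGroup F] [InnerProductSpace ℂ F] (ψ : E ⊗[ℂ] F) : ℕ∞ :=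
  sInf {m : ℕ∞ | ∃ (r : ℕ) (l : Fin r → ℝ) (e : Fin r → E) (f : Fin r → F),
    (∀ i, 0 < l i) ∧ Orthonormal ℂ e ∧ Orthonormal ℂ f ∧
      ψ = ∑ i, (l i : ℂ) • (e i ⊗ₜ[ℂ] f i) ∧ m = (r : ℕ∞)}

/-- Nonclassical number of a mixed state. -/
def nonclassicalNumber {ι E : Type*} [NormedAddCommGroup E] [InnerProductSpace ℂ E]
    (χ : ι → E) (ρ : E →ₗ[ℂ] E) : ℕ∞ :=
  mixedExtension (nonclassicalRank χ) ρ

/-- Schmidt number of a bipartite mixed state. -/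
def schmidtNumber {E F : Type*} [NormedAddCommGroup E] [InnerProductSpace ℂ E]
    [NormedAddCommGroup F] [InnerProductSpace ℂ F]
    (ρ : (E ⊗[ℂ] F) →ₗ[ℂ] (E ⊗[ℂ] F)) : ℕ∞ :=
  mixedExtension schmidtRank ρ

end

/-! The Gram matrix `M` of the classical states is positive definite with unit diagonal, so it
splits as a Hadamard product of two positive definite matrices (`Matrix.PosDef.exists_hadamard_eq`).
These are Gram matrices of independent families `a` and `b`, so `χ i ↦ a i ⊗ b i` preserves inner
products and extends to an isometry `Γ`. As `a` and `b` are independent, the Schmidt rank of `∑ c i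
• (a i ⊗ b i)` counts the nonzero `c i` (`schmidtRank_sum_smul_tmul`), which is the nonclassical
rank of the preimage. For mixed states, every pure decomposition of `ΓρΓ†` stays in the range of
`Γ`, hence comes from one of `ρ` (`mixedExtension_conj`). -/

open scoped ComplexOrder Matrix

/-! ### Tensor rank of sums of independent products -/

section TensorRank

variable {K E F : Type*} [Field K] [AddCommGroup E] [Module K E] [AddCommGroup F] [Module K F]

/-- The tensor rank of `∑ i, a i ⊗ b i` is at least the number of terms when `a` and `b` are
linearly independent. -/
theorem card_le_card_of_sum_tmul_eq {ι κ : Type*} [Fintype ι] [Fintype κ]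
    {a : κ → E} {b : κ → F} (ha : LinearIndependent K a) (hb : LinearIndependent K b)
    (x : ι → E) (y : ι → F) (h : ∑ i, a i ⊗ₜ[K] b i = ∑ j, x j ⊗ₜ[K] y j) :
    Fintype.card κ ≤ Fintype.card ι := by
  classical
  obtain ⟨g, hg⟩ := LinearMap.exists_leftInverse_of_injective
    (Finsupp.linearCombination K b) (LinearMap.ker_eq_bot.2 hb)
  have hgb (i : κ) : g (b i) = Finsupp.single i 1 := by
    simpa using LinearMap.congr_fun hg (Finsupp.single i 1)
  have hmem (i : κ) : a i ∈ Submodule.span K (Set.range x) := by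
    -- Contracting the second factor with the functional dual to `b i` isolates `a i` on the left
    -- and leaves a combination of the `x j` on the right.
    have h1 := congrArg (TensorProduct.rid K E)
      (congrArg (LinearMap.lTensor E (Finsupp.lapply i ∘ₗ g)) h)
    simp only [map_sum, LinearMap.lTensor_tmul, TensorProduct.rid_tmul, LinearMap.comp_apply,
      hgb, Finsupp.lapply_apply, Finsupp.single_apply, ite_smul, one_smul, zero_smul,
      Finset.sum_ite_eq', Finset.mem_univ, if_true] at h1
    rw [h1]
    exact Submodule.sum_mem _ fun j _ => Submodule.smul_mem _ _ (Submodule.subset_span ⟨j, rfl⟩)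
  have : Module.Finite K (Submodule.span K (Set.range x)) :=
    Module.Finite.span_of_finite K (Set.finite_range x)
  have hli : LinearIndependent K
      (fun i => (⟨a i, hmem i⟩ : Submodule.span K (Set.range x))) :=
    LinearIndependent.of_comp (Submodule.subtype _) ha
  exact hli.fintype_card_le_finrank.trans (finrank_range_le_card x)

end TensorRank

/-! ### Schmidt decomposition and Schmidt rank -/

section Schmidt

variable {E F : Type*} [NormedAddCommGroup E] [InnerProductSpace ℂ E]
  [NormedAddCommGroup F] [InnerProductSpace ℂ F]

/-- A finite family of vectors is made orthogonal by a unitary change of the family. -/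
theorem exists_unitary_pairwise_orthogonal {n : Type*} [Fintype n] [DecidableEq n] (x : n → E) :
    ∃ U ∈ Matrix.unitaryGroup n ℂ,
      ∀ k l, k ≠ l → inner ℂ (∑ j, U j k • x j) (∑ j, U j l • x j) = 0 := by
  have hM := Matrix.isHermitian_gram ℂ x
  refine ⟨hM.eigenvectorUnitary, hM.eigenvectorUnitary.2, fun k l hkl => ?_⟩
  set U : Matrix n n ℂ := (hM.eigenvectorUnitary : Matrix n n ℂ)
  -- The Gram matrix of the new family is `star U * gram x * U`, diagonal because the columns of `U`
  -- are eigenvectors.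
  have hd : star U * Matrix.gram ℂ x * U
      = Matrix.diagonal (RCLike.ofReal ∘ hM.eigenvalues) := by
    have h := hM.conjStarAlgAut_star_eigenvectorUnitary
    simpa [Unitary.conjStarAlgAut_apply] using h
  have h := congrFun (congrFun hd k) l
  rw [Matrix.diagonal_apply_ne _ hkl] at h
  rw [← h]
  simp only [sum_inner, inner_sum, inner_smul_left, inner_smul_right, Matrix.mul_apply,
    Finset.sum_mul, Matrix.star_apply, Matrix.gram_apply]
  refine Finset.sum_congr rfl fun i _ => ?_
  rw [Finset.mul_sum]
  refine Finset.sum_congr rfl fun j _ => ?_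
  simp only [starRingEnd_apply]
  ring

theorem orthonormal_sum_star_smul {n : Type*} [Fintype n] [DecidableEq n] {f : n → F}
    (hf : Orthonormal ℂ f) {U : Matrix n n ℂ} (hU : U ∈ Matrix.unitaryGroup n ℂ) :
    Orthonormal ℂ (fun k => ∑ j, star (U j k) • f j) := by
  rw [orthonormal_iff_ite]
  intro k l
  have h := congrFun (congrFun (Matrix.mem_unitaryGroup_iff'.1 hU) l) k
  rw [Matrix.mul_apply, Matrix.one_apply] at h
  rw [hf.inner_sum]
  simp only [Matrix.star_apply] at h
  simp only [starRingEnd_apply, star_star]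
  simp_rw [mul_comm (U _ k), h, eq_comm]

/-- Mixing one factor by `U` is undone by mixing the other by the conjugate of `U`, since `U * star
U = 1`. -/
theorem sum_tmul_unitary {n : Type*} [Fintype n] [DecidableEq n] (x : n → E) (f : n → F)
    {U : Matrix n n ℂ} (hU : U ∈ Matrix.unitaryGroup n ℂ) :
    ∑ k, (∑ i, U i k • x i) ⊗ₜ[ℂ] (∑ j, star (U j k) • f j) = ∑ j, x j ⊗ₜ[ℂ] f j := by
  have h (i j : n) : ∑ k, U i k * star (U j k) = if i = j then 1 else 0 := by
    have := congrFun (congrFun (Matrix.mem_unitaryGroup_iff.1 hU) i) j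
    rwa [Matrix.mul_apply, Matrix.one_apply] at this
  simp only [TensorProduct.sum_tmul, TensorProduct.tmul_sum, TensorProduct.smul_tmul_smul]
  rw [Finset.sum_comm]
  refine Finset.sum_congr rfl fun i _ => ?_
  rw [Finset.sum_comm]
  simp only [← Finset.sum_smul, h, ite_smul, one_smul, zero_smul,
    Finset.sum_ite_eq', Finset.mem_univ, if_true]

/-- Every bipartite vector has a Schmidt decomposition. -/
theorem exists_schmidt_decomposition [FiniteDimensional ℂ F] (φ : E ⊗[ℂ] F) :
    ∃ (r : ℕ) (l : Fin r → ℝ) (e : Fin r → E) (f : Fin r → F),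
      (∀ i, 0 < l i) ∧ Orthonormal ℂ e ∧ Orthonormal ℂ f ∧
        φ = ∑ i, (l i : ℂ) • (e i ⊗ₜ[ℂ] f i) := by
  classical
  let b := stdOrthonormalBasis ℂ F
  obtain ⟨x, hx⟩ : ∃ x : Fin (Module.finrank ℂ F) → E, φ = ∑ j, x j ⊗ₜ[ℂ] b j := by
    refine ⟨fun j => TensorProduct.equivFinsuppOfBasisRight b.toBasis φ j, ?_⟩
    have h := (TensorProduct.equivFinsuppOfBasisRight b.toBasis).symm_apply_apply φ
    rw [TensorProduct.equivFinsuppOfBasisRight_symm_apply,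
      Finsupp.sum_fintype _ _ (by simp)] at h
    simpa using h.symm
  obtain ⟨U, hU, horth⟩ := exists_unitary_pairwise_orthogonal x
  set v : Fin (Module.finrank ℂ F) → E := fun k => ∑ j, U j k • x j
  set g : Fin (Module.finrank ℂ F) → F := fun k => ∑ j, star (U j k) • b j
  have hgo : Orthonormal ℂ g := orthonormal_sum_star_smul b.orthonormal hU
  have hφ : φ = ∑ k, v k ⊗ₜ[ℂ] g k := by rw [hx, ← sum_tmul_unitary x b hU]
  -- Vanishing terms are dropped, since Schmidt coefficients must be positive.
  let S := {k // v k ≠ 0}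
  let σ : Fin (Fintype.card S) ≃ S := (Fintype.equivFin S).symm
  have hpos (i : S) : 0 < ‖v i‖ := norm_pos_iff.2 i.2
  have hne (i : S) : (‖v i‖ : ℂ) ≠ 0 := by exact_mod_cast (hpos i).ne'
  refine ⟨Fintype.card S, fun i => ‖v (σ i)‖, fun i => (‖v (σ i)‖ : ℂ)⁻¹ • v (σ i),
    fun i => g (σ i), fun i => hpos _, ⟨fun i => ?_, fun i j hij => ?_⟩,
    hgo.comp _ (Subtype.val_injective.comp σ.injective), ?_⟩
  · rw [norm_smul, norm_inv, Complex.norm_real, norm_norm, inv_mul_cancel₀ (hpos _).ne']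
  · have : (σ i).1 ≠ (σ j).1 := fun h => hij (σ.injective (Subtype.val_injective h))
    simp only [inner_smul_left, inner_smul_right]
    rw [horth _ _ this, mul_zero, mul_zero]
  · rw [σ.sum_comp (fun i : S => (‖v i‖ : ℂ) • (((‖v i‖ : ℂ)⁻¹ • v i) ⊗ₜ[ℂ] g i)), hφ]
    simp only [TensorProduct.smul_tmul', smul_inv_smul₀ (hne _)]
    rw [← Finset.sum_filter_of_ne (p := fun k => v k ≠ 0)]
    · exact Finset.sum_subtype _ (by simp) _
    · rintro k - hk h0
      exact hk (by rw [h0, TensorProduct.zero_tmul])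

/-- The Schmidt rank of a combination of products of linearly independent vectors is the number
of terms. -/
theorem schmidtRank_sum_smul_tmul [FiniteDimensional ℂ F] {ι : Type*} {a : ι → E} {b : ι → F}
    (ha : LinearIndependent ℂ a) (hb : LinearIndependent ℂ b) (s : Finset ι) (c : ι → ℂ)
    (hc : ∀ i ∈ s, c i ≠ 0) :
    schmidtRank (∑ i ∈ s, c i • (a i ⊗ₜ[ℂ] b i)) = (s.card : ℕ∞) := by
  have hsum : ∑ i ∈ s, c i • (a i ⊗ₜ[ℂ] b i) = ∑ i : s, (c i • a i) ⊗ₜ[ℂ] b i := by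
    rw [← Finset.sum_coe_sort]
    rfl
  have ha' : LinearIndependent ℂ (fun i : s => c i • a i) :=
    (ha.comp _ Subtype.val_injective).units_smul (fun i : s => Units.mk0 (c i) (hc i i.2))
  have hb' : LinearIndependent ℂ (fun i : s => b i) := hb.comp _ Subtype.val_injective
  -- Both bounds compare two expansions of the same tensor; the upper one also needs a Schmidt
  -- decomposition to exist.
  refine le_antisymm ?_ (le_sInf ?_)
  · obtain ⟨r, l, e, f, hl, he, hf, h⟩ :=
      exists_schmidt_decomposition (∑ i ∈ s, c i • (a i ⊗ₜ[ℂ] b i))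
    refine (show schmidtRank _ ≤ (r : ℕ∞) from sInf_le ⟨r, l, e, f, hl, he, hf, h, rfl⟩).trans ?_
    have he' : LinearIndependent ℂ (fun i => (l i : ℂ) • e i) :=
      he.linearIndependent.units_smul
        (fun i => Units.mk0 (l i : ℂ) (by exact_mod_cast (hl i).ne'))
    have := card_le_card_of_sum_tmul_eq he' hf.linearIndependent _ _ (h.symm.trans hsum)
    simpa using this
  · rintro m ⟨r, l, e, f, -, -, -, h, rfl⟩
    have := card_le_card_of_sum_tmul_eq ha' hb' (fun i => (l i : ℂ) • e i) f (hsum.symm.trans h)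
    simpa using this

end Schmidt

/-! ### Hadamard factorization of the Gram matrix and the isometry -/

section GramFactorization

open scoped MatrixOrder Matrix.Norms.L2Operator in
/-- A positive definite matrix is the Gram matrix of a linearly independent family. -/
theorem exists_linearIndependent_gram_eq {E n : Type*} [NormedAddCommGroup E]
    [InnerProductSpace ℂ E] [FiniteDimensional ℂ E] [Fintype n] [DecidableEq n]
    (hn : Module.finrank ℂ E = Fintype.card n) {M : Matrix n n ℂ} (hM : M.PosDef) :
    ∃ v : n → E, LinearIndependent ℂ v ∧ Matrix.gram ℂ v = M := by
  obtain ⟨B, rfl⟩ : ∃ B : Matrix n n ℂ, M = Bᴴ * B :=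
    CStarAlgebra.nonneg_iff_eq_star_mul_self.mp hM.posSemidef.nonneg
  let b : OrthonormalBasis n ℂ E :=
    (stdOrthonormalBasis ℂ E).reindex (Fintype.equivOfCardEq (by simp [hn]))
  -- The columns of `B` serve as coordinates in an orthonormal basis.
  have hg : Matrix.gram ℂ (fun i => ∑ k, B k i • b k) = Bᴴ * B := by
    ext i j
    rw [Matrix.gram_apply, b.orthonormal.inner_sum, Matrix.mul_apply]
    rfl
  exact ⟨_, Matrix.linearIndependent_of_posDef_gram (hg ▸ hM), hg⟩

theorem Matrix.PosDef.exists_sub_smul_one {n : Type*} [Fintype n] [DecidableEq n]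
    {M : Matrix n n ℂ} (hM : M.PosDef) :
    ∃ ε : ℝ, 0 < ε ∧ ε < 1 ∧ (M - (ε : ℂ) • (1 : Matrix n n ℂ)).PosDef := by
  -- `none` adjoins the value `1` to the eigenvalues; this gives `ε < 1` and covers empty `n`.
  obtain ⟨ε, h0, h1⟩ : ∃ ε : ℝ, 0 < ε ∧ ∀ i : Option n, ε < i.elim 1 hM.1.eigenvalues := by
    obtain ⟨i, hi⟩ := Finite.exists_min fun i : Option n => i.elim 1 hM.1.eigenvalues
    have hpos : 0 < i.elim 1 hM.1.eigenvalues := by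
      cases i
      · exact one_pos
      · exact hM.eigenvalues_pos _
    exact ⟨_, half_pos hpos, fun j => (half_lt_self hpos).trans_le (hi j)⟩
  refine ⟨ε, h0, h1 none, ?_⟩
  set U := hM.1.eigenvectorUnitary
  have h : M - (ε : ℂ) • (1 : Matrix n n ℂ) =
      (U : Matrix n n ℂ) * Matrix.diagonal (fun i => ((hM.1.eigenvalues i - ε : ℝ) : ℂ)) *
        star (U : Matrix n n ℂ) := by
    have hd : Matrix.diagonal (fun i => ((hM.1.eigenvalues i - ε : ℝ) : ℂ)) =
        Matrix.diagonal (RCLike.ofReal ∘ hM.1.eigenvalues) - (ε : ℂ) • (1 : Matrix n n ℂ) := by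
      ext i j
      by_cases hij : i = j
      · subst hij
        simp
      · simp [hij]
    rw [hd, mul_sub, sub_mul, mul_smul_comm, smul_mul_assoc, mul_one,
      Unitary.mul_star_self_of_mem U.2]
    congr 1
    exact hM.1.spectral_theorem
  rw [h, Matrix.IsUnit.posDef_star_right_conjugate_iff Unitary.isUnit_coe]
  exact Matrix.PosDef.diagonal fun i => by exact_mod_cast sub_pos.2 (h1 (some i))

/-- A positive definite matrix with unit diagonal is a Hadamard product of two positive definite
matrices. -/
theorem Matrix.PosDef.exists_hadamard_eq {n : Type*} [Fintype n] [DecidableEq n]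
    {M : Matrix n n ℂ} (hM : M.PosDef) (hdiag : ∀ i, M i i = 1) :
    ∃ A B : Matrix n n ℂ, A.PosDef ∧ B.PosDef ∧ A ⊙ B = M := by
  obtain ⟨ε, h0, h1, hε⟩ := hM.exists_sub_smul_one
  have h1' : 0 < 1 - ε := sub_pos.2 h1
  have hc : (1 - ε : ℂ) ≠ 0 := by exact_mod_cast h1'.ne'
  -- With `J` the all-ones matrix, `A = ε + (1 - ε)J` and `B = (M - ε) / (1 - ε)`: both have unit
  -- diagonal, and off it the factors `1 - ε` cancel.
  refine ⟨(ε : ℂ) • 1 + ((1 - ε : ℝ) : ℂ) • Matrix.vecMulVec (fun _ => 1) (star fun _ => 1),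
    (((1 - ε)⁻¹ : ℝ) : ℂ) • (M - (ε : ℂ) • (1 : Matrix n n ℂ)), ?_, ?_, ?_⟩
  · exact (Matrix.PosDef.one.smul (by exact_mod_cast h0)).add_posSemidef
      ((Matrix.posSemidef_vecMulVec_self_star _).smul (by exact_mod_cast h1'.le))
  · exact hε.smul (by exact_mod_cast inv_pos.2 h1')
  · ext i j
    by_cases hij : i = j
    · subst hij
      simp [Matrix.vecMulVec_apply, hdiag, hc]
    · simp [Matrix.vecMulVec_apply, Matrix.one_apply_ne hij, hc]

/-- An isometry sending the basis `χ` to products of linearly independent vectors. -/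
theorem exists_linearIsometry_tmul {H F : Type*}
    [NormedAddCommGroup H] [InnerProductSpace ℂ H] [FiniteDimensional ℂ H]
    [NormedAddCommGroup F] [InnerProductSpace ℂ F] [FiniteDimensional ℂ F]
    {ι : Type*} [Fintype ι] [DecidableEq ι]
    (hF : Module.finrank ℂ F = Fintype.card ι) (χ : Module.Basis ι ℂ H) (hunit : ∀ i, ‖χ i‖ = 1) :
    ∃ (Γ : H →ₗᵢ[ℂ] H ⊗[ℂ] F) (a : ι → H) (b : ι → F), LinearIndependent ℂ a ∧
      LinearIndependent ℂ b ∧ ∀ i, Γ (χ i) = a i ⊗ₜ[ℂ] b i := by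
  obtain ⟨A, B, hA, hB, hAB⟩ :=
    (Matrix.posDef_gram_of_linearIndependent χ.linearIndependent).exists_hadamard_eq
      (fun i => by simp [Matrix.gram_apply, hunit])
  obtain ⟨a, ha, rfl⟩ :=
    exists_linearIndependent_gram_eq (Module.finrank_eq_card_basis χ) hA
  obtain ⟨b, hb, rfl⟩ := exists_linearIndependent_gram_eq hF hB
  let L : H →ₗ[ℂ] H ⊗[ℂ] F := χ.constr ℂ fun i => a i ⊗ₜ[ℂ] b i
  have hL (i : ι) : L (χ i) = a i ⊗ₜ[ℂ] b i := χ.constr_basis _ _ _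
  have hinner (x y : H) : inner ℂ (L x) (L y) = inner ℂ x y := by
    rw [← χ.sum_repr x, ← χ.sum_repr y]
    simp only [map_sum, map_smul, hL, sum_inner, inner_sum, TensorProduct.smul_tmul',
      TensorProduct.inner_tmul]
    refine Finset.sum_congr rfl fun i _ => Finset.sum_congr rfl fun j _ => ?_
    have h := congrFun (congrFun hAB j) i
    simp only [Matrix.hadamard_apply, Matrix.gram_apply] at h
    simp only [inner_smul_left, inner_smul_right, ← h]
    ring
  exact ⟨L.isometryOfInner hinner, a, b, ha, hb, hL⟩

end GramFactorization

/-! ### Pure-state decompositions under an isometry -/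

section MixedExtension

@[simp]
theorem ketBra_apply {E : Type*} [NormedAddCommGroup E] [InnerProductSpace ℂ E] (ψ x : E) :
    ketBra ψ x = inner ℂ ψ x • ψ := rfl

variable {E F : Type*} [NormedAddCommGroup E] [InnerProductSpace ℂ E] [FiniteDimensional ℂ E]
  [NormedAddCommGroup F] [InnerProductSpace ℂ F] [FiniteDimensional ℂ F]

theorem LinearIsometry.adjoint_apply_self (Γ : E →ₗᵢ[ℂ] F) (x : E) :
    LinearMap.adjoint Γ.toLinearMap (Γ x) = x :=
  ext_inner_right ℂ fun y => by
    rw [LinearMap.adjoint_inner_left]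
    exact Γ.inner_map_map x y

theorem ketBra_linearIsometry (Γ : E →ₗᵢ[ℂ] F) (ψ : E) :
    ketBra (Γ ψ) = Γ.toLinearMap ∘ₗ ketBra ψ ∘ₗ LinearMap.adjoint Γ.toLinearMap := by
  ext x
  simp [LinearMap.adjoint_inner_right]

theorem conj_sum_smul_ketBra (Γ : E →ₗᵢ[ℂ] F) {n : ℕ} (p : Fin n → ℝ) (ψ : Fin n → E) :
    Γ.toLinearMap ∘ₗ (∑ i, (p i : ℂ) • ketBra (ψ i)) ∘ₗ LinearMap.adjoint Γ.toLinearMap =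
      ∑ i, (p i : ℂ) • ketBra (Γ (ψ i)) := by
  ext x
  simp only [LinearMap.comp_apply, LinearMap.sum_apply, map_sum, ketBra_linearIsometry,
    LinearMap.smul_apply, map_smul]

theorem isPureDecomposition_conj_iff (Γ : E →ₗᵢ[ℂ] F) (ρ : E →ₗ[ℂ] E) {n : ℕ} (p : Fin n → ℝ)
    (ψ : Fin n → E) :
    IsPureDecomposition (Γ.toLinearMap ∘ₗ ρ ∘ₗ LinearMap.adjoint Γ.toLinearMap) p
      (fun i => Γ (ψ i)) ↔ IsPureDecomposition ρ p ψ := by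
  refine ⟨fun h => ⟨h.pos, h.sum_eq_one, fun i => by simpa using h.norm_eq_one i, ?_⟩,
    fun h => ⟨h.pos, h.sum_eq_one, fun i => by simpa using h.norm_eq_one i, ?_⟩⟩
  · have h2 := h.eq_sum
    rw [← conj_sum_smul_ketBra] at h2
    ext x
    -- At `Γ x` the adjoint cancels `Γ`, and injectivity removes the outer one.
    have h3 := LinearMap.congr_fun h2 (Γ x)
    simp only [LinearMap.comp_apply, LinearIsometry.adjoint_apply_self] at h3
    exact Γ.injective h3
  · rw [← conj_sum_smul_ketBra, ← h.eq_sum]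

/-- The vectors of a pure-state decomposition lie in every subspace containing the range. -/
theorem IsPureDecomposition.mem_of_range_le {σ : F →ₗ[ℂ] F} {n : ℕ} {p : Fin n → ℝ}
    {φ : Fin n → F} (h : IsPureDecomposition σ p φ) {V : Submodule ℂ F}
    (hV : LinearMap.range σ ≤ V) (i : Fin n) : φ i ∈ V := by
  rw [← V.orthogonal_orthogonal, Submodule.mem_orthogonal']
  intro v hv
  -- For `v ⟂ V`, `⟪v, σ v⟫ = 0` is a sum of nonnegative terms `p j * ‖⟪φ j, v⟫‖ ^ 2`, so each `φ j`
  -- is orthogonal to `v`.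
  have h0 : inner ℂ v (σ v) = 0 := V.mem_orthogonal' v |>.1 hv _ (hV ⟨v, rfl⟩)
  have h1 : inner ℂ v (σ v) = ((∑ j, p j * ‖inner ℂ (φ j) v‖ ^ 2 : ℝ) : ℂ) := by
    rw [h.eq_sum, LinearMap.sum_apply, inner_sum]
    push_cast
    refine Finset.sum_congr rfl fun j _ => ?_
    rw [LinearMap.smul_apply, ketBra_apply, inner_smul_right, inner_smul_right,
      ← inner_conj_symm v (φ j), Complex.mul_conj, Complex.normSq_eq_norm_sq]
    push_cast
    rfl
  rw [h0, eq_comm, Complex.ofReal_eq_zero, Finset.sum_eq_zero_iff_of_nonneg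
    (fun j _ => mul_nonneg (h.pos j).le (sq_nonneg _))] at h1
  simpa [(h.pos i).ne'] using h1 i (Finset.mem_univ i)

/-- Conjugation by an isometry preserves mixed extensions of compatible rank functions. -/
theorem mixedExtension_conj (Γ : E →ₗᵢ[ℂ] F) {R : E → ℕ∞} {R' : F → ℕ∞}
    (hR : ∀ ψ, R' (Γ ψ) = R ψ) (ρ : E →ₗ[ℂ] E) :
    mixedExtension R' (Γ.toLinearMap ∘ₗ ρ ∘ₗ LinearMap.adjoint Γ.toLinearMap) =
      mixedExtension R ρ := by
  unfold mixedExtension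
  congr 1
  ext m
  constructor
  · rintro ⟨n, p, φ, h, rfl⟩
    have hmem (i : Fin n) : φ i ∈ LinearMap.range Γ.toLinearMap :=
      h.mem_of_range_le (LinearMap.range_comp_le_range _ _) i
    choose ψ hψ using hmem
    obtain rfl : (fun i => Γ (ψ i)) = φ := funext hψ
    exact ⟨n, p, ψ, (isPureDecomposition_conj_iff Γ ρ p ψ).1 h, by simp [hR]⟩
  · rintro ⟨n, p, ψ, h, rfl⟩
    exact ⟨n, p, _, (isPureDecomposition_conj_iff Γ ρ p ψ).2 h, by simp [hR]⟩

end MixedExtension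

/-! ### Matching the two ranks, and the conclusion -/

theorem schmidtRank_apply_eq_nonclassicalRank {H F ι : Type*}
    [NormedAddCommGroup H] [InnerProductSpace ℂ H]
    [NormedAddCommGroup F] [InnerProductSpace ℂ F] [FiniteDimensional ℂ F] [Fintype ι]
    (χ : Module.Basis ι ℂ H) (Γ : H →ₗᵢ[ℂ] H ⊗[ℂ] F) {a : ι → H} {b : ι → F}
    (ha : LinearIndependent ℂ a) (hb : LinearIndependent ℂ b)
    (hΓ : ∀ i, Γ (χ i) = a i ⊗ₜ[ℂ] b i) (ψ : H) :
    schmidtRank (Γ ψ) = nonclassicalRank χ ψ := by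
  classical
  have key (s : Finset ι) (c : ι → ℂ) (hc : ∀ i ∈ s, c i ≠ 0) (h : ψ = ∑ i ∈ s, c i • χ i) :
      schmidtRank (Γ ψ) = s.card := by
    rw [h, map_sum]
    simp only [map_smul, hΓ]
    exact schmidtRank_sum_smul_tmul ha hb s c hc
  refine le_antisymm (le_sInf ?_) (sInf_le ?_)
  · rintro r ⟨s, c, hc, h, rfl⟩
    exact (key s c hc h).le
  -- The basis coordinates supply an expansion with nonzero coefficients, so the infimum is
  -- attained.
  · have hs : ∀ i ∈ (χ.repr ψ).support, χ.repr ψ i ≠ 0 := fun i hi => Finsupp.mem_support_iff.1 hi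
    have h : ψ = ∑ i ∈ (χ.repr ψ).support, χ.repr ψ i • χ i := (χ.linearCombination_repr ψ).symm
    exact ⟨_, _, hs, h, key _ _ hs h⟩

theorem proposition1 {H Hanc : Type*}
    [NormedAddCommGroup H] [InnerProductSpace ℂ H] [FiniteDimensional ℂ H]
    [NormedAddCommGroup Hanc] [InnerProductSpace ℂ Hanc] [FiniteDimensional ℂ Hanc]
    (hanc : Nonempty (H ≃ₗᵢ[ℂ] Hanc))
    (d : ℕ) (hd : Module.finrank ℂ H = d)
    (χ : Fin d → H) (hunit : ∀ i, ‖χ i‖ = 1)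
    (hli : LinearIndependent ℂ χ) (hspan : Submodule.span ℂ (Set.range χ) = ⊤) :
    ∃ Γ : H →ₗᵢ[ℂ] H ⊗[ℂ] Hanc, ∀ ρ : H →ₗ[ℂ] H, IsDensityOperator ρ →
      nonclassicalNumber χ ρ =
        schmidtNumber (Γ.toLinearMap ∘ₗ ρ ∘ₗ LinearMap.adjoint Γ.toLinearMap) := by
  obtain ⟨u⟩ := hanc
  let β : Module.Basis (Fin d) ℂ H := Module.Basis.mk hli hspan.ge
  have hβ : ⇑β = χ := Module.Basis.coe_mk hli hspan.ge
  obtain ⟨Γ, a, b, ha, hb, hΓ⟩ := exists_linearIsometry_tmul (F := Hanc)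
    (by rw [← u.toLinearEquiv.finrank_eq, hd, Fintype.card_fin]) β
    (fun i => by rw [hβ]; exact hunit i)
  refine ⟨Γ, fun ρ _ => ?_⟩
  rw [← hβ]
  exact (mixedExtension_conj Γ (schmidtRank_apply_eq_nonclassicalRank β Γ ha hb hΓ) ρ).symm
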